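/- **Theorem.** Let $G$ be a finite group with pseudo-exponent $\alpha$ and character degrees $d_1,\dots,d_k$, and let $\omega$ be the exponent of matrix multiplication over $\mathbb{C}$. Then $$|G|^{\omega/\alpha}\;\le\;\sum_{i=1}^k d_i^{\,\omega}.$$ Here the terms are defined as follows. * For a finite subset $S\subseteq G$ put $Q(S)=\{s_1s_2^{-1}: s_1,s_2\in S\}$. The group $G$ *realizes* $\langle n,m,p\rangle$ if there are subsets $S_1,S_2,S_3\subseteq G$ with $|S_1|=n$, $|S_2|=m$, $|S_3|=p$ such that, for all $q_i\in Q(S_i)$, $q_1q_2q_3=1$ implies $q_1=q_2=q_3=1$. * The *pseudo-exponent* $\alpha=\alpha(G)$ of a non-trivial finite group $G$ is the minimum of $\dfrac{3\log|G|}{\log(nmp)}$ over all positive integers $n,m,p$, not all equal to $1$, such that $G$ realizes $\langle n,m,p\rangle$. The pseudo-exponent of the trivial group is $3$. * The *character degrees* of $G$ are the positive integers $d_1,\dots,d_k$ (listed with multiplicity) in a decomposition $\mathbb{C}[G]\cong\prod_{i=1}^k \mathbb{C}^{d_i\times d_i}$ of the group algebra as a direct product of matrix algebras. * $\omega$ is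 the smallest real number such that for every $\varepsilon>0$ two complex $n\times n$ matrices can be multiplied with $O(n^{\omega+\varepsilon})$ field operations. Field operations are counted in straight-line computations, which may differ for different $n$: starting from the matrix entries and arbitrary complex constants, each addition, subtraction, multiplication or division (by a quantity that is nonzero for all inputs) costs one operation. -/

import Mathlib

noncomputable section

/-! ### The triple product property and the pseudo-exponent -/

/-- The right quotient set `Q(S) = {s₁ s₂⁻¹ : s₁, s₂ ∈ S}`. -/
def rightQuotientSet {G : Type*} [Group G] (S : Finset G) : Set G :=
  {q | ∃ s₁ ∈ S, ∃ s₂ ∈ S, q = s₁ * s₂⁻¹}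

/-- The triple product property of three finite subsets of a group. -/
def TripleProductProperty {G : Type*} [Group G] (S₁ S₂ S₃ : Finset G) : Prop :=
  ∀ q₁ ∈ rightQuotientSet S₁, ∀ q₂ ∈ rightQuotientSet S₂, ∀ q₃ ∈ rightQuotientSet S₃,
    q₁ * q₂ * q₃ = 1 → q₁ = 1 ∧ q₂ = 1 ∧ q₃ = 1

/-- `G` realizes `⟨n₁, n₂, n₃⟩`. -/
def Realizes (G : Type*) [Group G] (n₁ n₂ n₃ : ℕ) : Prop :=
  ∃ S₁ S₂ S₃ : Finset G, S₁.card = n₁ ∧ S₂.card = n₂ ∧ S₃.card = n₃ ∧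
    TripleProductProperty S₁ S₂ S₃

/-- The values `3 log |G| / log (nmp)`, over all positive integers `n, m, p`, not all `1`, such
that `G` realizes `⟨n, m, p⟩`. -/
def pseudoExponentValues (G : Type*) [Group G] : Set ℝ :=
  {a | ∃ n m p : ℕ, 0 < n ∧ 0 < m ∧ 0 < p ∧ ¬ (n = 1 ∧ m = 1 ∧ p = 1) ∧ Realizes G n m p ∧
    a = 3 * Real.log (Nat.card G) / Real.log ((n * m * p : ℕ) : ℝ)}

open Classical in
/-- The pseudo-exponent `α(G)` of a finite group: the minimum of `pseudoExponentValues G` if `G`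
is non-trivial (see `isLeast_pseudoExponent`), and `3` if `G` is trivial. -/
def pseudoExponent (G : Type*) [Group G] : ℝ :=
  if Nontrivial G then sInf (pseudoExponentValues G) else 3

/-- For a non-trivial finite group the infimum in `pseudoExponent` is a minimum. -/
theorem isLeast_pseudoExponent (G : Type*) [Group G] [Finite G] [Nontrivial G] :
    IsLeast (pseudoExponentValues G) (pseudoExponent G) := by
  classical
  have := Fintype.ofFinite G
  have hfin : (pseudoExponentValues G).Finite := by
    have hsub : pseudoExponentValues G ⊆
        (fun t : Finset G × Finset G × Finset G =>
          3 * Real.log (Nat.card G) /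
            Real.log ((t.1.card * t.2.1.card * t.2.2.card : ℕ) : ℝ)) '' Set.univ := by
      rintro a ⟨n, m, p, -, -, -, -, ⟨S₁, S₂, S₃, rfl, rfl, rfl, -⟩, rfl⟩
      exact ⟨(S₁, S₂, S₃), trivial, rfl⟩
    exact (Set.finite_univ.image _).subset hsub
  have hne : (pseudoExponentValues G).Nonempty := by
    refine ⟨_, 1, 1, Fintype.card G, one_pos, one_pos, Fintype.card_pos, ?_,
      ⟨{1}, {1}, Finset.univ, by simp, by simp, by simp, ?_⟩, rfl⟩
    · have := Fintype.one_lt_card (α := G)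
      omega
    · rintro q₁ ⟨a, ha, b, hb, rfl⟩ q₂ ⟨c, hc, d, hd, rfl⟩ q₃ - h
      simp_all
  have hdef : pseudoExponent G = sInf (pseudoExponentValues G) := by
    unfold pseudoExponent
    rw [if_pos ‹Nontrivial G›]
  rw [hdef]
  exact ⟨hne.csInf_mem hfin, fun a ha => csInf_le hfin.bddBelow ha⟩

/-! ### Character degrees -/

/-- `d₁, …, d_k` are the character degrees of `G`, listed with multiplicity: the orders of the
matrix algebras in a decomposition of `ℂ[G]` as a direct product of matrix algebras over `ℂ`. -/
def IsCharacterDegrees (G : Type*) [Group G] {k : ℕ} (d : Fin k → ℕ) : Prop :=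
  (∀ i, 0 < d i) ∧
    Nonempty (MonoidAlgebra ℂ G ≃ₐ[ℂ] ((i : Fin k) → Matrix (Fin (d i)) (Fin (d i)) ℂ))

/-- Every finite group has character degrees. -/
theorem exists_isCharacterDegrees (G : Type*) [Group G] [Finite G] :
    ∃ (k : ℕ) (d : Fin k → ℕ), IsCharacterDegrees G d := by
  classical
  have := Fintype.ofFinite G
  have : NeZero (Nat.card G : ℂ) := ⟨by exact_mod_cast Nat.card_pos.ne'⟩
  obtain ⟨k, d, hd, e⟩ :=
    IsSemisimpleRing.exists_algEquiv_pi_matrix_of_isAlgClosed ℂ (MonoidAlgebra ℂ G)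
  exact ⟨k, d, fun i => Nat.pos_of_ne_zero (hd i).out, e⟩

/-! ### Field operations and the exponent of matrix multiplication -/

/-- Straight-line computations over `ℂ` with input variables indexed by `ι`.
`StraightLine L S` says that some sequence of `L` field operations makes exactly the functions in
`S` available: at the start these are the inputs and the complex constants, and each operation
`+`, `-`, `*`, `/` costs one step and adds its result, computed from two available functions (a
division is permitted only if the divisor vanishes at no input). -/
inductive StraightLine {ι : Type} : ℕ → Set ((ι → ℂ) → ℂ) → Prop
  | start : StraightLine 0 {f | (∃ i : ι, f = fun x => x i) ∨ ∃ c : ℂ, f = fun _ => c}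
  | add {L : ℕ} {S : Set ((ι → ℂ) → ℂ)} {f g : (ι → ℂ) → ℂ} :
      StraightLine L S → f ∈ S → g ∈ S → StraightLine (L + 1) (insert (fun x => f x + g x) S)
  | sub {L : ℕ} {S : Set ((ι → ℂ) → ℂ)} {f g : (ι → ℂ) → ℂ} :
      StraightLine L S → f ∈ S → g ∈ S → StraightLine (L + 1) (insert (fun x => f x - g x) S)
  | mul {L : ℕ} {S : Set ((ι → ℂ) → ℂ)} {f g : (ι → ℂ) → ℂ} :
      StraightLine L S → f ∈ S → g ∈ S → StraightLine (L + 1) (insert (fun x => f x * g x) S)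
  | div {L : ℕ} {S : Set ((ι → ℂ) → ℂ)} {f g : (ι → ℂ) → ℂ} :
      StraightLine L S → f ∈ S → g ∈ S → (∀ x, g x ≠ 0) →
        StraightLine (L + 1) (insert (fun x => f x / g x) S)

/-- The entries of two `n × n` matrices: the input variables of matrix multiplication. -/
abbrev MatMulVars (n : ℕ) : Type := (Fin n × Fin n) ⊕ (Fin n × Fin n)

/-- The left input matrix. -/
def leftMatrix {n : ℕ} (x : MatMulVars n → ℂ) : Matrix (Fin n) (Fin n) ℂ :=
  Matrix.of fun i j => x (Sum.inl (i, j))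

/-- The right input matrix. -/
def rightMatrix {n : ℕ} (x : MatMulVars n → ℂ) : Matrix (Fin n) (Fin n) ℂ :=
  Matrix.of fun i j => x (Sum.inr (i, j))

/-- Two complex `n × n` matrices can be multiplied with `L` field operations: some straight-line
computation of length `L` computes all entries of the product. -/
def MatMulInOps (n L : ℕ) : Prop :=
  ∃ S : Set ((MatMulVars n → ℂ) → ℂ), StraightLine L S ∧
    ∀ i j : Fin n, (fun x => (leftMatrix x * rightMatrix x) i j) ∈ S

/-- The exponent `ω` of matrix multiplication over `ℂ`: the smallest number `w` such that for each
`ε > 0`, `n × n` matrices can be multiplied with `O(n ^ (w + ε))` field operations. -/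
def matMulExponent : ℝ :=
  sInf {w : ℝ | ∀ ε : ℝ, 0 < ε → ∃ C : ℝ, ∀ n : ℕ, 0 < n →
    ∃ L : ℕ, (L : ℝ) ≤ C * (n : ℝ) ^ (w + ε) ∧ MatMulInOps n L}

end

/-!
The exponent `ω` is governed by the rank of the tensor of matrix multiplication. On the one hand, a
computation with `L` operations gives a decomposition of rank at most `2 * L`: restricted to a line
through the origin every computed function is a polynomial (a nowhere vanishing divisor is then
constant), each multiplication contributes one product of two linear forms to the quadratic parts,
and the entries of the product matrix are themselves quadratic. On the other hand, a decomposition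
of rank `r` for `N × N` matrices is a bilinear algorithm, and applying it recursively to blocks
gives `ω ≤ log_N r`. Multiplying a rectangular format with its rotations, one gets
`(n * m * p) ^ ω ≤ r ^ 3` whenever the tensor of the format `⟨n, m, p⟩` has rank at most `r`.

The triple product property makes this tensor a restriction of the structure tensor of `ℂ[G]`, by
sending the matrix positions `(i, j)`, `(j, k)`, `(k, i)` to `i⁻¹ * j`, `j⁻¹ * k`, `k⁻¹ * i`. The
decomposition of `ℂ[G]` into matrix algebras writes the structure tensor as a sum of traces of
products of `dᵢ × dᵢ` matrices, so that its rank is at most about `∑ i, dᵢ ^ ω`. The constants and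
the `ε` in the definition of `ω` disappear on passing to powers of `G`.
-/

/-! ### Tensor rank -/

/-- The tensor with coordinates `T x y z` has rank at most `r`: it is a sum of `r` tensors of rank
one. -/
def TensorRankLE {R X Y Z : Type*} [CommSemiring R] (T : X → Y → Z → R) (r : ℕ) : Prop :=
  ∃ (u : Fin r → X → R) (v : Fin r → Y → R) (w : Fin r → Z → R),
    ∀ x y z, T x y z = ∑ i, u i x * v i y * w i z

namespace TensorRankLE

variable {R X Y Z X' Y' Z' : Type*} [CommSemiring R] {T : X → Y → Z → R} {r r' : ℕ}

theorem of_fintype {ρ : Type*} [Fintype ρ] (u : ρ → X → R) (v : ρ → Y → R) (w : ρ → Z → R)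
    (h : ∀ x y z, T x y z = ∑ i, u i x * v i y * w i z) : TensorRankLE T (Fintype.card ρ) := by
  let e := (Fintype.equivFin ρ).symm
  refine ⟨fun i => u (e i), fun i => v (e i), fun i => w (e i), fun x y z => ?_⟩
  rw [h]
  exact (e.sum_comp fun i => u i x * v i y * w i z).symm

theorem congr {T' : X → Y → Z → R} (h : TensorRankLE T r) (hT : ∀ x y z, T x y z = T' x y z) :
    TensorRankLE T' r := by
  obtain ⟨u, v, w, h⟩ := h
  exact ⟨u, v, w, fun x y z => (hT x y z).symm.trans (h x y z)⟩

theorem mono (h : TensorRankLE T r) (hr : r ≤ r') : TensorRankLE T r' := by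
  obtain ⟨k, rfl⟩ := Nat.exists_eq_add_of_le hr
  obtain ⟨u, v, w, h⟩ := h
  exact ⟨Fin.append u 0, Fin.append v 0, Fin.append w 0, fun x y z => by
    simp [h, Fin.sum_univ_add]⟩

theorem comap (h : TensorRankLE T r) (a : X' → X) (b : Y' → Y) (c : Z' → Z) :
    TensorRankLE (fun x y z => T (a x) (b y) (c z)) r := by
  obtain ⟨u, v, w, h⟩ := h
  exact ⟨fun i x => u i (a x), fun i y => v i (b y), fun i z => w i (c z), fun x y z => h _ _ _⟩

theorem rotate (h : TensorRankLE T r) : TensorRankLE (fun y z x => T x y z) r := by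
  obtain ⟨u, v, w, h⟩ := h
  refine ⟨v, w, u, fun y z x => (h x y z).trans ?_⟩
  exact Finset.sum_congr rfl fun i _ => by ring

theorem mul {T' : X' → Y' → Z' → R} (h : TensorRankLE T r) (h' : TensorRankLE T' r') :
    TensorRankLE (fun (x : X × X') (y : Y × Y') (z : Z × Z') => T x.1 y.1 z.1 * T' x.2 y.2 z.2)
      (r * r') := by
  obtain ⟨u, v, w, h⟩ := h
  obtain ⟨u', v', w', h'⟩ := h'
  rw [← Fintype.card_fin r, ← Fintype.card_fin r', ← Fintype.card_prod]
  refine of_fintype (fun i x => u i.1 x.1 * u' i.2 x.2) (fun i y => v i.1 y.1 * v' i.2 y.2)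
    (fun i z => w i.1 z.1 * w' i.2 z.2) fun x y z => ?_
  rw [h, h', Finset.sum_mul_sum, Fintype.sum_prod_type]
  exact Finset.sum_congr rfl fun i _ => Finset.sum_congr rfl fun j _ => by ring

theorem sum {σ : Type*} [Fintype σ] {T : σ → X → Y → Z → R} {r : σ → ℕ}
    (h : ∀ s, TensorRankLE (T s) (r s)) :
    TensorRankLE (fun x y z => ∑ s, T s x y z) (∑ s, r s) := by
  choose u v w h using h
  have hcard : Fintype.card ((s : σ) × Fin (r s)) = ∑ s, r s := by simp
  rw [← hcard]
  refine of_fintype (fun i => u i.1 i.2) (fun i => v i.1 i.2) (fun i => w i.1 i.2) fun x y z => ?_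
  rw [Fintype.sum_sigma]
  exact Finset.sum_congr rfl fun s _ => h s x y z

end TensorRankLE

/-! ### The matrix multiplication tensor -/

/-- The tensor of the multiplication of `I × J` by `J × K` matrices, in its cyclically symmetric
form: the coefficients of the trilinear form `(A, B, C) ↦ tr (A * B * C)`. -/
def matMulTensor (R I J K : Type*) [CommSemiring R] [DecidableEq I] [DecidableEq J]
    [DecidableEq K] : I × J → J × K → K × I → R :=
  fun x y z => if x.2 = y.1 ∧ y.2 = z.1 ∧ z.2 = x.1 then 1 else 0

section MatMulTensor

variable {R I J K I' J' K' : Type*} [CommSemiring R] [DecidableEq I] [DecidableEq J]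
  [DecidableEq K] [DecidableEq I'] [DecidableEq J'] [DecidableEq K'] {r r' : ℕ}

theorem tensorRankLE_matMulTensor [Fintype I] [Fintype J] [Fintype K] :
    TensorRankLE (matMulTensor R I J K) (Fintype.card (I × J × K)) := by
  refine .of_fintype (fun s x => if x = (s.1, s.2.1) then 1 else 0)
    (fun s y => if y = (s.2.1, s.2.2) then 1 else 0)
    (fun s z => if z = (s.2.2, s.1) then 1 else 0) fun x y z => ?_
  rw [Finset.sum_eq_single (x.1, x.2, y.2)]
  · simp only [matMulTensor, Prod.ext_iff]
    grind
  · rintro ⟨i, j, k⟩ - hne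
    simp only [Prod.ext_iff, ne_eq] at hne ⊢
    grind
  · simp

theorem TensorRankLE.matMulTensor_rotate (h : TensorRankLE (matMulTensor R I J K) r) :
    TensorRankLE (matMulTensor R J K I) r :=
  h.rotate.congr fun _ _ _ => if_congr (by tauto) rfl rfl

theorem TensorRankLE.matMulTensor_congr (h : TensorRankLE (matMulTensor R I J K) r)
    (e : I' ≃ I) (f : J' ≃ J) (g : K' ≃ K) : TensorRankLE (matMulTensor R I' J' K') r :=
  (h.comap (Prod.map e f) (Prod.map f g) (Prod.map g e)).congr fun x y z => by
    simp [matMulTensor]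

theorem TensorRankLE.matMulTensor_prod (h : TensorRankLE (matMulTensor R I J K) r)
    (h' : TensorRankLE (matMulTensor R I' J' K') r') :
    TensorRankLE (matMulTensor R (I × I') (J × J') (K × K')) (r * r') := by
  refine ((h.mul h').comap (Equiv.prodProdProdComm I I' J J') (Equiv.prodProdProdComm J J' K K')
    (Equiv.prodProdProdComm K K' I I')).congr fun x y z => ?_
  simp only [matMulTensor, Equiv.prodProdProdComm_apply, Prod.ext_iff, mul_ite, mul_one, mul_zero,
    ← ite_and]
  congr 1
  exact propext (by tauto)

/-- The product of a rectangular format with its two rotations is a square format. -/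
theorem TensorRankLE.matMulTensor_square [Fintype I] [Fintype J] [Fintype K] {n : Type*}
    [Fintype n] [DecidableEq n] (h : TensorRankLE (matMulTensor R I J K) r)
    (hn : Fintype.card n = Fintype.card I * Fintype.card J * Fintype.card K) :
    TensorRankLE (matMulTensor R n n n) (r ^ 3) := by
  have h₂ := h.matMulTensor_rotate
  have h₃ := h₂.matMulTensor_rotate
  rw [show r ^ 3 = r * r * r by ring]
  refine ((h.matMulTensor_prod h₂).matMulTensor_prod h₃).matMulTensor_congr
    (Fintype.equivOfCardEq ?_) (Fintype.equivOfCardEq ?_) (Fintype.equivOfCardEq ?_) <;>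
    simp only [hn, Fintype.card_prod] <;> ring

/-- This is the bilinear algorithm given by a decomposition of the tensor. In block recursion `𝒜` is
itself a matrix algebra. -/
theorem mul_apply_eq_sum_of_matMulTensor_eq [Fintype I] [Fintype J] [Fintype K]
    {ρ 𝒜 : Type*} [Fintype ρ] [Semiring 𝒜] [Algebra R 𝒜]
    {u : ρ → I × J → R} {v : ρ → J × K → R} {w : ρ → K × I → R}
    (h : ∀ x y z, matMulTensor R I J K x y z = ∑ t, u t x * v t y * w t z)
    (A : Matrix I J 𝒜) (B : Matrix J K 𝒜) (i : I) (k : K) :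
    (A * B) i k =
      ∑ t, w t (k, i) • ((∑ x, u t x • A x.1 x.2) * ∑ y, v t y • B y.1 y.2) := by
  have hterm (x : I × J) (y : J × K) :
      (∑ t, w t (k, i) • (u t x • A x.1 x.2 * v t y • B y.1 y.2)) =
        matMulTensor R I J K x y (k, i) • (A x.1 x.2 * B y.1 y.2) := by
    rw [h, Finset.sum_smul]
    refine Finset.sum_congr rfl fun t _ => ?_
    rw [smul_mul_smul_comm, smul_smul, mul_comm (w t _)]
  calc (A * B) i k
      = ∑ x : I × J, ∑ y : J × K, matMulTensor R I J K x y (k, i) • (A x.1 x.2 * B y.1 y.2) := by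
        simp only [Matrix.mul_apply, matMulTensor, ite_smul, one_smul, zero_smul,
          Fintype.sum_prod_type, ite_and]
        simp
    _ = ∑ x, ∑ y, ∑ t, w t (k, i) • (u t x • A x.1 x.2 * v t y • B y.1 y.2) := by
        simp only [hterm]
    _ = ∑ t, ∑ x, ∑ y, w t (k, i) • (u t x • A x.1 x.2 * v t y • B y.1 y.2) := by
        simp only [Finset.sum_comm (γ := ρ)]
    _ = _ := by simp only [Finset.sum_mul_sum, Finset.smul_sum]

theorem TensorRankLE.trace_mul_mul [Fintype I] [Fintype J] [Fintype K] {X Y Z : Type*}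
    (h : TensorRankLE (matMulTensor R I J K) r) (A : X → Matrix I J R) (B : Y → Matrix J K R)
    (C : Z → Matrix K I R) : TensorRankLE (fun x y z => (A x * B y * C z).trace) r := by
  obtain ⟨u, v, w, h⟩ := h
  refine ⟨fun t x => ∑ s, u t s * A x s.1 s.2, fun t y => ∑ s, v t s * B y s.1 s.2,
    fun t z => ∑ i, ∑ k, w t (k, i) * C z k i, fun x y z => ?_⟩
  calc (A x * B y * C z).trace = ∑ i, ∑ k, (A x * B y) i k * C z k i := rfl
    _ = ∑ i, ∑ k, ∑ t, (∑ s, u t s * A x s.1 s.2) * (∑ s, v t s * B y s.1 s.2) *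
          (w t (k, i) * C z k i) := by
        simp only [mul_apply_eq_sum_of_matMulTensor_eq h, smul_eq_mul,
          Finset.sum_mul (ι := Fin r)]
        exact Finset.sum_congr rfl fun i _ => Finset.sum_congr rfl fun k _ =>
          Finset.sum_congr rfl fun t _ => by ring
    _ = _ := by simp only [Finset.sum_comm (γ := Fin r), Finset.mul_sum]

theorem TensorRankLE.card_mul_card_le {R : Type*} [CommRing R] [Nontrivial R] [Fintype I]
    [Nonempty J] [Fintype K] (h : TensorRankLE (matMulTensor R I J K) r) :
    Fintype.card I * Fintype.card K ≤ r := by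
  obtain ⟨u, v, w, h⟩ := h
  obtain ⟨j⟩ := ‹Nonempty J›
  let A : Matrix (I × K) (Fin r) R := .of fun x t => u t (x.1, j) * v t (j, x.2)
  let W : Matrix (Fin r) (I × K) R := .of fun t x => w t x.swap
  have hAW : A * W = 1 := by
    ext x x'
    rw [Matrix.mul_apply, Matrix.one_apply]
    refine (h (x.1, j) (j, x.2) x'.swap).symm.trans ?_
    simp only [matMulTensor, Prod.ext_iff, Prod.fst_swap, Prod.snd_swap]
    congr 1
    exact propext (by tauto)
  calc Fintype.card I * Fintype.card K = (A * W).rank := by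
        rw [hAW, Matrix.rank_one, Fintype.card_prod]
    _ ≤ A.rank := Matrix.rank_mul_le_left A W
    _ ≤ r := by simpa using A.rank_le_card_width

end MatMulTensor

/-! ### From straight-line computations to tensor rank -/

open Polynomial in
/-- Along each line through the origin `f` is a polynomial whose coefficients of degree `0` and `1`
are a constant and a linear form, and whose coefficient of degree `2` is a function in `Q`. -/
def HasQuadraticPartIn {R V : Type*} [CommRing R] [AddCommGroup V] [Module R V]
    (Q : Submodule R (V → R)) (f : V → R) : Prop :=
  ∃ (c : R) (l : Module.Dual R V), ∃ q ∈ Q, ∀ x, ∃ p : R[X],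
    (∀ t, f (t • x) = p.eval t) ∧ p.coeff 0 = c ∧ p.coeff 1 = l x ∧ p.coeff 2 = q x

namespace HasQuadraticPartIn

section CommRing

variable {R V : Type*} [CommRing R] [AddCommGroup V] [Module R V] {Q Q' : Submodule R (V → R)}
  {f g : V → R}

theorem mono (h : HasQuadraticPartIn Q f) (hQ : Q ≤ Q') : HasQuadraticPartIn Q' f := by
  obtain ⟨c, l, q, hq, hp⟩ := h
  exact ⟨c, l, q, hQ hq, hp⟩

theorem const (Q : Submodule R (V → R)) (c : R) : HasQuadraticPartIn Q fun _ => c :=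
  ⟨c, 0, 0, Q.zero_mem, fun _ => ⟨.C c, by simp, by simp, by simp, by simp⟩⟩

theorem linear (Q : Submodule R (V → R)) (l : Module.Dual R V) : HasQuadraticPartIn Q l :=
  ⟨0, l, 0, Q.zero_mem, fun x => ⟨.C (l x) * .X, fun t => by simp [mul_comm t], by simp, by simp,
    by simp⟩⟩

theorem add (hf : HasQuadraticPartIn Q f) (hg : HasQuadraticPartIn Q g) :
    HasQuadraticPartIn Q fun x => f x + g x := by
  obtain ⟨c, l, q, hq, hf⟩ := hf
  obtain ⟨d, m, s, hs, hg⟩ := hg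
  refine ⟨c + d, l + m, q + s, Q.add_mem hq hs, fun x => ?_⟩
  obtain ⟨p, hp, h₀, h₁, h₂⟩ := hf x
  obtain ⟨r, hr, k₀, k₁, k₂⟩ := hg x
  exact ⟨p + r, by simp [hp, hr], by simp [h₀, k₀], by simp [h₁, k₁], by simp [h₂, k₂]⟩

theorem const_mul (a : R) (hf : HasQuadraticPartIn Q f) :
    HasQuadraticPartIn Q fun x => a * f x := by
  obtain ⟨c, l, q, hq, hf⟩ := hf
  refine ⟨a * c, a • l, a • q, Q.smul_mem a hq, fun x => ?_⟩
  obtain ⟨p, hp, h₀, h₁, h₂⟩ := hf x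
  exact ⟨.C a * p, by simp [hp], by simp [h₀], by simp [h₁], by simp [h₂]⟩

theorem sub (hf : HasQuadraticPartIn Q f) (hg : HasQuadraticPartIn Q g) :
    HasQuadraticPartIn Q fun x => f x - g x := by
  simpa [sub_eq_add_neg] using hf.add (hg.const_mul (-1))

theorem mul (hf : HasQuadraticPartIn Q f) (hg : HasQuadraticPartIn Q g) :
    ∃ l m : Module.Dual R V,
      HasQuadraticPartIn (Submodule.span R {⇑l * ⇑m} ⊔ Q) fun x => f x * g x := by
  obtain ⟨c, l, q, hq, hf⟩ := hf
  obtain ⟨d, m, s, hs, hg⟩ := hg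
  refine ⟨l, m, c * d, c • m + d • l, ⇑l * ⇑m + (c • s + d • q),
    Submodule.add_mem_sup (Submodule.mem_span_singleton_self _)
      (Q.add_mem (Q.smul_mem c hs) (Q.smul_mem d hq)), fun x => ?_⟩
  obtain ⟨p, hp, h₀, h₁, h₂⟩ := hf x
  obtain ⟨r, hr, k₀, k₁, k₂⟩ := hg x
  refine ⟨p * r, by simp [hp, hr], by simp [Polynomial.mul_coeff_zero, h₀, k₀], ?_, ?_⟩
  · simp [Polynomial.mul_coeff_one, h₀, k₀, h₁, k₁, mul_comm d]
  · simp only [Polynomial.coeff_mul, Finset.Nat.sum_antidiagonal_eq_sum_range_succ_mk,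
      Finset.sum_range_succ, Finset.sum_range_zero, Nat.reduceSub, h₀, k₀, h₁, k₁, h₂, k₂,
      Pi.add_apply, Pi.mul_apply, Pi.smul_apply, smul_eq_mul]
    ring

end CommRing

section Field

variable {K V : Type*} [Field K] [AddCommGroup V] [Module K V] {Q : Submodule K (V → K)}
  {f g : V → K}

theorem exists_eq_const_of_forall_ne_zero [IsAlgClosed K] (hg : HasQuadraticPartIn Q g)
    (h : ∀ x, g x ≠ 0) : ∃ d, ∀ x, g x = d := by
  obtain ⟨d, _, _, _, hp⟩ := hg
  refine ⟨d, fun x => ?_⟩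
  obtain ⟨p, hp, h₀, -, -⟩ := hp x
  have hdeg : p.degree = 0 := by
    by_contra hne
    obtain ⟨t, ht⟩ := IsAlgClosed.exists_root p hne
    exact h (t • x) ((hp t).trans ht)
  rw [Polynomial.eq_C_of_degree_eq_zero hdeg, h₀] at hp
  simpa using hp 1

theorem div [IsAlgClosed K] (hf : HasQuadraticPartIn Q f) (hg : HasQuadraticPartIn Q g)
    (h : ∀ x, g x ≠ 0) : HasQuadraticPartIn Q fun x => f x / g x := by
  obtain ⟨d, hd⟩ := hg.exists_eq_const_of_forall_ne_zero h
  simpa only [hd, div_eq_inv_mul] using hf.const_mul d⁻¹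

theorem mem_of_homogeneous [Infinite K] (hf : HasQuadraticPartIn Q f)
    (h : ∀ (t : K) x, f (t • x) = t ^ 2 * f x) : f ∈ Q := by
  obtain ⟨c, l, q, hq, hf⟩ := hf
  convert hq using 1
  ext x
  obtain ⟨p, hp, -, -, h₂⟩ := hf x
  have hpX : p = .C (f x) * .X ^ 2 := Polynomial.funext fun t => by
    simp [← hp, h, mul_comm (t ^ 2)]
  simp [← h₂, hpX]

end Field

end HasQuadraticPartIn

/-- The span of the products of the pairs of linear forms in `P`. -/
def productSpan {R V : Type*} [CommRing R] [AddCommGroup V] [Module R V]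
    (P : Finset (Module.Dual R V × Module.Dual R V)) : Submodule R (V → R) :=
  Submodule.span R
    ((fun p : Module.Dual R V × Module.Dual R V => ⇑p.1 * ⇑p.2) '' (P : Set _))

theorem StraightLine.exists_forall_hasQuadraticPartIn {ι : Type} {L : ℕ}
    {S : Set ((ι → ℂ) → ℂ)} (h : StraightLine L S) :
    ∃ P : Finset (Module.Dual ℂ (ι → ℂ) × Module.Dual ℂ (ι → ℂ)), P.card ≤ L ∧
      ∀ f ∈ S, HasQuadraticPartIn (productSpan P) f := by
  classical
  induction h with
  | start =>
    refine ⟨∅, le_rfl, ?_⟩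
    rintro f (⟨i, rfl⟩ | ⟨c, rfl⟩)
    · exact .linear _ (LinearMap.proj i : Module.Dual ℂ (ι → ℂ))
    · exact .const _ c
  | add _ hf hg ih =>
    obtain ⟨P, hP, ih⟩ := ih
    exact ⟨P, hP.trans (Nat.le_succ _), Set.forall_mem_insert.2 ⟨(ih _ hf).add (ih _ hg), ih⟩⟩
  | sub _ hf hg ih =>
    obtain ⟨P, hP, ih⟩ := ih
    exact ⟨P, hP.trans (Nat.le_succ _), Set.forall_mem_insert.2 ⟨(ih _ hf).sub (ih _ hg), ih⟩⟩
  | mul _ hf hg ih =>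
    obtain ⟨P, hP, ih⟩ := ih
    obtain ⟨l, m, hfg⟩ := (ih _ hf).mul (ih _ hg)
    have hspan : productSpan (insert (l, m) P) = Submodule.span ℂ {⇑l * ⇑m} ⊔ productSpan P := by
      rw [productSpan, Finset.coe_insert, Set.image_insert_eq, Submodule.span_insert, productSpan]
    refine ⟨insert (l, m) P, (Finset.card_insert_le _ _).trans (Nat.succ_le_succ hP),
      Set.forall_mem_insert.2 ⟨hspan ▸ hfg, fun e he => (ih e he).mono ?_⟩⟩
    exact hspan ▸ le_sup_right
  | div _ hf hg hne ih =>
    obtain ⟨P, hP, ih⟩ := ih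
    exact ⟨P, hP.trans (Nat.le_succ _),
      Set.forall_mem_insert.2 ⟨(ih _ hf).div (ih _ hg) hne, ih⟩⟩

theorem tensorRankLE_polar {R V Z : Type*} [CommRing R] [AddCommGroup V] [Module R V]
    {P : Finset (Module.Dual R V × Module.Dual R V)} {q : Z → V → R}
    (h : ∀ z, q z ∈ productSpan P) :
    TensorRankLE (fun x y z => QuadraticMap.polar (q z) x y) (2 * P.card) := by
  have hq (z : Z) : ∃ w : P → R, ∀ x, q z x = ∑ p : P, w p * (p.1.1 x * p.1.2 x) := by
    obtain ⟨w, hw⟩ := (Submodule.mem_span_image_finset_iff_exists_fun R).1 (h z)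
    refine ⟨fun p => w p, fun x => ?_⟩
    simp [← hw]
  choose w hw using hq
  have hcard : Fintype.card (P ⊕ P) = 2 * P.card := by simp [two_mul]
  rw [← hcard]
  refine .of_fintype (fun p x => Sum.elim (fun p => p.1.1 x) (fun p => p.1.2 x) p)
    (fun p y => Sum.elim (fun p => p.1.2 y) (fun p => p.1.1 y) p)
    (fun p z => Sum.elim (w z) (w z) p) fun x y z => ?_
  simp only [QuadraticMap.polar, hw, Fintype.sum_sum_type, Sum.elim_inl, Sum.elim_inr,
    ← Finset.sum_add_distrib, ← Finset.sum_sub_distrib, map_add]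
  exact Finset.sum_congr rfl fun p _ => by ring

theorem polar_leftMatrix_mul_rightMatrix_apply {n : ℕ} (i k : Fin n) (x y : MatMulVars n → ℂ) :
    QuadraticMap.polar (fun x => (leftMatrix x * rightMatrix x) i k) x y =
      (leftMatrix x * rightMatrix y + leftMatrix y * rightMatrix x) i k := by
  have hl : leftMatrix (x + y) = leftMatrix x + leftMatrix y := rfl
  have hr : rightMatrix (x + y) = rightMatrix x + rightMatrix y := rfl
  simp only [QuadraticMap.polar, hl, hr, add_mul, mul_add, Matrix.add_apply]
  ring

/-- Polarizing the entries of the product recovers the matrix multiplication tensor: no product of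
two left or of two right variables occurs in them. -/
theorem MatMulInOps.tensorRankLE_matMulTensor {n L : ℕ} (h : MatMulInOps n L) :
    TensorRankLE (matMulTensor ℂ (Fin n) (Fin n) (Fin n)) (2 * L) := by
  obtain ⟨S, hS, hmem⟩ := h
  obtain ⟨P, hP, hquad⟩ := hS.exists_forall_hasQuadraticPartIn
  have hq (z : Fin n × Fin n) :
      (fun x => (leftMatrix x * rightMatrix x) z.2 z.1) ∈ productSpan P :=
    (hquad _ (hmem z.2 z.1)).mem_of_homogeneous fun t x => by
      have hl : leftMatrix (t • x) = t • leftMatrix x := rfl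
      have hr : rightMatrix (t • x) = t • rightMatrix x := rfl
      simp only [hl, hr, smul_mul_smul_comm, Matrix.smul_apply, smul_eq_mul, sq]
  have hpolar := ((tensorRankLE_polar hq).mono (Nat.mul_le_mul_left 2 hP)).comap
    (fun s : Fin n × Fin n => Pi.single (Sum.inl s) 1)
    (fun s : Fin n × Fin n => Pi.single (Sum.inr s) 1) id
  have hl (s : Fin n × Fin n) : leftMatrix (Pi.single (Sum.inr s) 1) = 0 := by
    ext; simp [leftMatrix]
  have hL (s : Fin n × Fin n) : leftMatrix (Pi.single (Sum.inl s) 1) = Matrix.single s.1 s.2 1 := by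
    ext; simp [leftMatrix, Matrix.single_apply, Pi.single_apply, Prod.ext_iff, eq_comm]
  have hR (s : Fin n × Fin n) :
      rightMatrix (Pi.single (Sum.inr s) 1) = Matrix.single s.1 s.2 1 := by
    ext; simp [rightMatrix, Matrix.single_apply, Pi.single_apply, Prod.ext_iff, eq_comm]
  refine hpolar.congr fun x y z => ?_
  rw [polar_leftMatrix_mul_rightMatrix_apply, hl, hL, hR, zero_mul, add_zero]
  simp only [id, matMulTensor, Matrix.mul_apply, Matrix.single_apply, mul_ite, mul_one, mul_zero,
    ite_and, Finset.sum_ite_eq, Finset.mem_univ, if_true]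
  grind

/-! ### Building straight-line computations -/

section Cost

variable {ι : Type} {A B D F F' : Set ((ι → ℂ) → ℂ)} {c c' : ℕ}

theorem StraightLine.const_mem {L : ℕ} {S : Set ((ι → ℂ) → ℂ)} (h : StraightLine L S) (a : ℂ) :
    Function.const (ι → ℂ) a ∈ S := by
  induction h with
  | start => exact Or.inr ⟨a, rfl⟩
  | add _ _ _ ih => exact Or.inr ih
  | sub _ _ _ ih => exact Or.inr ih
  | mul _ _ _ ih => exact Or.inr ih
  | div _ _ _ _ ih => exact Or.inr ih

/-- The functions in `F` can be computed from those in `A` with `c` operations: each computation in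
which the functions in `A` are available can be continued with `c` operations so that those in `F`
are available as well. -/
def CostLE (A F : Set ((ι → ℂ) → ℂ)) (c : ℕ) : Prop :=
  ∀ ⦃L S⦄, StraightLine L S → A ⊆ S → ∃ S', S ⊆ S' ∧ StraightLine (L + c) S' ∧ F ⊆ S'

namespace CostLE

theorem of_subset (h : F ⊆ A ∪ Set.range (Function.const (ι → ℂ))) : CostLE A F 0 :=
  fun _ S hS hA => ⟨S, subset_rfl, hS,
    h.trans (Set.union_subset hA (Set.range_subset_iff.2 hS.const_mem))⟩

theorem mono (h : CostLE A F c) (hA : A ⊆ B) (hF : F' ⊆ F) : CostLE B F' c := fun _ _ hS hB => by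
  obtain ⟨S', hSS', hS', hFS'⟩ := h hS (hA.trans hB)
  exact ⟨S', hSS', hS', hF.trans hFS'⟩

theorem trans (h : CostLE A B c) (h' : CostLE B D c') : CostLE A D (c + c') := fun L S hS hA => by
  obtain ⟨S₁, hSS₁, hS₁, hB⟩ := h hS hA
  obtain ⟨S₂, hSS₂, hS₂, hD⟩ := h' hS₁ hB
  exact ⟨S₂, hSS₁.trans hSS₂, by rwa [← add_assoc], hD⟩

theorem union (h : CostLE A B c) (h' : CostLE A D c') : CostLE A (B ∪ D) (c + c') :=
    fun L S hS hA => by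
  obtain ⟨S₁, hSS₁, hS₁, hB⟩ := h hS hA
  obtain ⟨S₂, hSS₂, hS₂, hD⟩ := h' hS₁ (hA.trans hSS₁)
  exact ⟨S₂, hSS₁.trans hSS₂, by rwa [← add_assoc], Set.union_subset (hB.trans hSS₂) hD⟩

theorem biUnion {κ : Type*} {F : κ → Set ((ι → ℂ) → ℂ)} (s : Finset κ)
    (h : ∀ k ∈ s, CostLE A (F k) c) : CostLE A (⋃ k ∈ s, F k) (s.card * c) := by
  classical
  induction s using Finset.induction_on with
  | empty => simpa using of_subset (A := A) (Set.empty_subset _)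
  | insert a s ha ih =>
    rw [Finset.card_insert_of_notMem ha, Nat.succ_mul, Finset.set_biUnion_insert, Set.union_comm]
    exact (ih fun k hk => h k (Finset.mem_insert_of_mem hk)).union
      (h a (Finset.mem_insert_self a s))

theorem iUnion {κ : Type*} [Fintype κ] {F : κ → Set ((ι → ℂ) → ℂ)}
    (h : ∀ k, CostLE A (F k) c) : CostLE A (⋃ k, F k) (Fintype.card κ * c) := by
  simpa using biUnion Finset.univ fun k _ => h k

theorem sum_smul {κ : Type*} {s : Finset κ} {f : κ → (ι → ℂ) → ℂ} (hf : ∀ k ∈ s, f k ∈ A)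
    (w : κ → ℂ) : CostLE A {∑ k ∈ s, w k • f k} (s.card * 2) := by
  classical
  induction s using Finset.induction_on with
  | empty => exact fun L S hS _ => ⟨S, subset_rfl, hS, by simpa using! hS.const_mem 0⟩
  | insert a s ha ih =>
    intro L S hS hA
    obtain ⟨S', hSS', hS', hsum⟩ := ih (fun k hk => hf k (Finset.mem_insert_of_mem hk)) hS hA
    have hmul := hS'.mul (hS'.const_mem (w a)) (hSS' (hA (hf a (Finset.mem_insert_self a s))))
    have hadd := hmul.add (Set.mem_insert _ _) (Set.mem_insert_of_mem _ (hsum rfl))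
    have hcard : L + s.card * 2 + 1 + 1 = L + (insert a s).card * 2 := by
      rw [Finset.card_insert_of_notMem ha]
      ring
    refine ⟨_, (hSS'.trans (Set.subset_insert _ _)).trans (Set.subset_insert _ _), hcard ▸ hadd, ?_⟩
    rw [Finset.sum_insert ha, Set.singleton_subset_iff]
    exact Set.mem_insert _ _

end CostLE

/-- The set of entries of a matrix. -/
def entries {m n α : Type*} (M : Matrix m n α) : Set α := Set.range fun s : m × n => M s.1 s.2

theorem mem_entries {m n α : Type*} (M : Matrix m n α) (i : m) (j : n) : M i j ∈ entries M :=
  ⟨(i, j), rfl⟩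

theorem entries_subset_iff {m n α : Type*} {M : Matrix m n α} {s : Set α} :
    entries M ⊆ s ↔ ∀ i j, M i j ∈ s := by
  simp [entries, Set.range_subset_iff]

theorem entries_submatrix_subset {m n m' n' α : Type*} (M : Matrix m n α) (f : m' → m)
    (g : n' → n) : entries (M.submatrix f g) ⊆ entries M :=
  entries_subset_iff.2 fun _ _ => mem_entries M _ _

theorem CostLE.entries_sum_smul {m n κ : Type*} [Fintype m] [Fintype n] [Fintype κ]
    {M : κ → Matrix m n ((ι → ℂ) → ℂ)} (hM : ∀ k, entries (M k) ⊆ A) (w : κ → ℂ) :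
    CostLE A (entries (∑ k, w k • M k)) (Fintype.card (m × n) * (Fintype.card κ * 2)) := by
  rw [entries, ← Set.iUnion_singleton_eq_range]
  refine CostLE.iUnion fun s => ?_
  simpa only [Matrix.sum_apply, Matrix.smul_apply] using!
    CostLE.sum_smul (fun k _ => hM k (mem_entries (M k) s.1 s.2)) w

/-- Two matrices of functions, with rows and columns indexed by `n`, can be multiplied with `c`
operations. In contrast to `MatMulInOps`, the entries need not be independent variables, so that
multiplications can be nested. -/
def MatMulCostLE (n : Type*) [Fintype n] (c : ℕ) : Prop :=
  ∀ ⦃ι : Type⦄ (A B : Matrix n n ((ι → ℂ) → ℂ)), CostLE (entries A ∪ entries B) (entries (A * B)) c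

namespace MatMulCostLE

variable {n m : Type*} [Fintype n] [Fintype m]

theorem matMulInOps {n : ℕ} (h : MatMulCostLE (Fin n) c) : MatMulInOps n c := by
  let X : Matrix (Fin n) (Fin n) ((MatMulVars n → ℂ) → ℂ) := .of fun i j x => leftMatrix x i j
  let Y : Matrix (Fin n) (Fin n) ((MatMulVars n → ℂ) → ℂ) := .of fun i j x => rightMatrix x i j
  obtain ⟨S, -, hS, hXY⟩ := h X Y .start <| Set.union_subset
    (entries_subset_iff.2 fun i j => Or.inl ⟨Sum.inl (i, j), rfl⟩)
    (entries_subset_iff.2 fun i j => Or.inl ⟨Sum.inr (i, j), rfl⟩)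
  refine ⟨S, zero_add c ▸ hS, fun i k => ?_⟩
  convert entries_subset_iff.1 hXY i k using 1
  ext x
  simp [Matrix.mul_apply, X, Y]

theorem of_equiv (h : MatMulCostLE n c) (e : n ≃ m) : MatMulCostLE m c := fun ι A B => by
  refine (h (A.submatrix e e) (B.submatrix e e)).mono
    (Set.union_subset_union (entries_submatrix_subset A e e) (entries_submatrix_subset B e e)) ?_
  rw [Matrix.submatrix_mul_equiv]
  exact entries_subset_iff.2 fun i k => ⟨(e.symm i, e.symm k), by simp⟩

theorem of_sum (h : MatMulCostLE (n ⊕ m) c) : MatMulCostLE n c := fun ι A B => by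
  have hpad (M : Matrix n n ((ι → ℂ) → ℂ)) : entries (Matrix.fromBlocks M 0 0 (0 : Matrix m m _)) ⊆
      entries M ∪ Set.range (Function.const (ι → ℂ)) := by
    refine entries_subset_iff.2 ?_
    rintro (i | i) (j | j)
    · exact Or.inl (mem_entries M i j)
    all_goals exact Or.inr ⟨0, rfl⟩
  have hfree : CostLE (entries A ∪ entries B)
      (entries (Matrix.fromBlocks A 0 0 (0 : Matrix m m _)) ∪
        entries (Matrix.fromBlocks B 0 0 (0 : Matrix m m _))) 0 :=
    .of_subset <| Set.union_subset
      ((hpad A).trans (Set.union_subset_union_left _ Set.subset_union_left))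
      ((hpad B).trans (Set.union_subset_union_left _ Set.subset_union_right))
  rw [← zero_add c]
  refine (hfree.trans (h _ _)).mono subset_rfl ?_
  rw [Matrix.fromBlocks_multiply]
  exact entries_subset_iff.2 fun i k => ⟨(Sum.inl i, Sum.inl k), by simp⟩

theorem of_card_le (h : MatMulCostLE m c) (hnm : Fintype.card n ≤ Fintype.card m) :
    MatMulCostLE n c :=
  (h.of_equiv (m := n ⊕ Fin (Fintype.card m - Fintype.card n))
    (Fintype.equivOfCardEq (by simp [hnm]))).of_sum

theorem of_unique [Unique n] : MatMulCostLE n 1 := fun ι A B L S hS hAB => by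
  refine ⟨_, Set.subset_insert _ S, hS.mul (hAB (Or.inl (mem_entries A default default)))
    (hAB (Or.inr (mem_entries B default default))), entries_subset_iff.2 fun i k => Or.inl ?_⟩
  rw [Unique.eq_default i, Unique.eq_default k, Matrix.mul_apply, Fintype.sum_unique]
  rfl

/-- The bilinear algorithm of rank `r` is run on `m × m` blocks. The constant `6` counts two
operations for each entry and coefficient in each of its three families of linear combinations. -/
theorem prod_of_tensorRankLE [DecidableEq n] {r : ℕ}
    (hr : TensorRankLE (matMulTensor ℂ n n n) r) (h : MatMulCostLE m c) :
    MatMulCostLE (n × m) (r * c + 6 * r * Fintype.card n ^ 2 * Fintype.card m ^ 2) := by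
  classical
  intro ι A B
  obtain ⟨u, v, w, huvw⟩ := hr
  let blocks := (Matrix.compRingEquiv n m ((ι → ℂ) → ℂ)).symm
  let U (t : Fin r) : Matrix m m ((ι → ℂ) → ℂ) := ∑ x, u t x • blocks A x.1 x.2
  let V (t : Fin r) : Matrix m m ((ι → ℂ) → ℂ) := ∑ y, v t y • blocks B y.1 y.2
  have hentries (M : Matrix (n × m) (n × m) ((ι → ℂ) → ℂ)) (x : n × n) :
      entries (blocks M x.1 x.2) ⊆ entries M :=
    entries_subset_iff.2 fun p q => mem_entries M (x.1, p) (x.2, q)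
  have hU : CostLE (entries A ∪ entries B) (⋃ t, entries (U t)) _ := .iUnion fun t =>
    .entries_sum_smul (fun x => (hentries A x).trans Set.subset_union_left) (u t)
  have hV : CostLE (entries A ∪ entries B) (⋃ t, entries (V t)) _ := .iUnion fun t =>
    .entries_sum_smul (fun y => (hentries B y).trans Set.subset_union_right) (v t)
  have hUV : CostLE ((⋃ t, entries (U t)) ∪ ⋃ t, entries (V t)) (⋃ t, entries (U t * V t)) _ :=
    .iUnion fun t => (h (U t) (V t)).mono (Set.union_subset_union
      (Set.subset_iUnion (fun t => entries (U t)) t)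
      (Set.subset_iUnion (fun t => entries (V t)) t)) subset_rfl
  have hW : CostLE (⋃ t, entries (U t * V t))
      (⋃ s : n × n, entries (∑ t, w t (s.2, s.1) • (U t * V t))) _ := .iUnion fun s =>
    .entries_sum_smul (fun t => Set.subset_iUnion (fun t => entries (U t * V t)) t) _
  have hcost : r * c + 6 * r * Fintype.card n ^ 2 * Fintype.card m ^ 2 =
      Fintype.card (Fin r) * (Fintype.card (m × m) * (Fintype.card (n × n) * 2)) +
      Fintype.card (Fin r) * (Fintype.card (m × m) * (Fintype.card (n × n) * 2)) +
      Fintype.card (Fin r) * c +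
      Fintype.card (n × n) * (Fintype.card (m × m) * (Fintype.card (Fin r) * 2)) := by
    simp only [Fintype.card_prod, Fintype.card_fin]
    ring
  rw [hcost]
  refine (((hU.union hV).trans hUV).trans hW).mono subset_rfl ?_
  simp only [U, V, ← mul_apply_eq_sum_of_matMulTensor_eq huvw, ← map_mul]
  exact entries_subset_iff.2 fun i k => Set.mem_iUnion.2 ⟨(i.1, k.1), (i.2, k.2), rfl⟩

theorem pow_of_tensorRankLE [DecidableEq n] [Nonempty n] {r : ℕ}
    (hr : TensorRankLE (matMulTensor ℂ n n n) r) (k : ℕ) :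
    ∃ c ≤ (1 + 6 * Fintype.card n ^ 2 * k) * r ^ k, MatMulCostLE (Fin k → n) c := by
  induction k with
  | zero => exact ⟨1, by simp, of_unique⟩
  | succ k ih =>
    obtain ⟨c, hc, h⟩ := ih
    refine ⟨_, ?_, (prod_of_tensorRankLE hr h).of_equiv (Fin.consEquiv fun _ => n)⟩
    have hpow : Fintype.card (Fin k → n) ^ 2 ≤ r ^ k := by
      rw [Fintype.card_fun, Fintype.card_fin, ← pow_mul, mul_comm, pow_mul, sq]
      exact Nat.pow_le_pow_left hr.card_mul_card_le k
    calc r * c + 6 * r * Fintype.card n ^ 2 * Fintype.card (Fin k → n) ^ 2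
        ≤ r * ((1 + 6 * Fintype.card n ^ 2 * k) * r ^ k) + 6 * r * Fintype.card n ^ 2 * r ^ k := by
          gcongr
      _ = (1 + 6 * Fintype.card n ^ 2 * (k + 1)) * r ^ (k + 1) := by ring

end MatMulCostLE

end Cost

/-! ### The exponent of matrix multiplication and tensor rank -/

theorem le_of_forall_pow_le_mul_pow {x y C : ℝ} (hx : 0 ≤ x) (h : ∀ l : ℕ, y ^ l ≤ C * x ^ l) :
    y ≤ x := by
  by_contra! hlt
  have hy : 0 < y := hx.trans_lt hlt
  have htend : Filter.Tendsto (fun l : ℕ => C * (x / y) ^ l) Filter.atTop (nhds (C * 0)) :=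
    (tendsto_pow_atTop_nhds_zero_of_lt_one (by positivity) ((div_lt_one hy).2 hlt)).const_mul C
  have hone : (1 : ℝ) ≤ C * 0 := ge_of_tendsto' htend fun l => by
    rw [div_pow, ← mul_div_assoc, le_div_iff₀ (by positivity), one_mul]
    exact h l
  linarith

theorem le_of_forall_natCast_rpow_le_mul_rpow {s t C : ℝ}
    (h : ∀ n : ℕ, 0 < n → (n : ℝ) ^ s ≤ C * (n : ℝ) ^ t) : s ≤ t := by
  have htwo : (2 : ℝ) ^ s ≤ 2 ^ t :=
    le_of_forall_pow_le_mul_pow (C := C) (by positivity) fun l => by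
      simpa only [Nat.cast_pow, Nat.cast_ofNat, Real.rpow_pow_comm zero_le_two] using
        h (2 ^ l) (by positivity)
  exact (Real.rpow_le_rpow_left_iff one_lt_two).1 htwo

theorem one_add_mul_le_mul_pow {a ρ : ℝ} (ha : 0 ≤ a) (hρ : 1 < ρ) (k : ℕ) :
    1 + a * k ≤ (1 + a / (ρ - 1)) * ρ ^ k := by
  have hρ' : 0 < ρ - 1 := sub_pos.2 hρ
  have hk : (k : ℝ) ≤ ρ ^ k / (ρ - 1) := by
    rw [le_div_iff₀ hρ']
    have bernoulli := one_add_mul_le_pow (show -2 ≤ ρ - 1 by linarith) k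
    rw [add_sub_cancel] at bernoulli
    linarith
  calc 1 + a * k ≤ ρ ^ k + a * (ρ ^ k / (ρ - 1)) := by
        gcongr
        exact one_le_pow₀ hρ.le
    _ = (1 + a / (ρ - 1)) * ρ ^ k := by ring

/-- The set of real numbers of which `matMulExponent` is the infimum. -/
def matMulExponentSet : Set ℝ :=
  {w : ℝ | ∀ ε : ℝ, 0 < ε → ∃ C : ℝ, ∀ n : ℕ, 0 < n →
    ∃ L : ℕ, (L : ℝ) ≤ C * (n : ℝ) ^ (w + ε) ∧ MatMulInOps n L}

theorem two_le_of_mem_matMulExponentSet {w : ℝ} (hw : w ∈ matMulExponentSet) : 2 ≤ w := by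
  refine le_of_forall_pos_le_add fun ε hε => ?_
  obtain ⟨C, hC⟩ := hw ε hε
  refine le_of_forall_natCast_rpow_le_mul_rpow (C := 2 * C) fun n hn => ?_
  obtain ⟨L, hL, h⟩ := hC n hn
  have := Fin.pos_iff_nonempty.1 hn
  have hsq : n ^ 2 ≤ 2 * L := by simpa [sq] using h.tensorRankLE_matMulTensor.card_mul_card_le
  calc (n : ℝ) ^ (2 : ℝ) ≤ 2 * L := by exact_mod_cast hsq
    _ ≤ 2 * C * (n : ℝ) ^ (w + ε) := by linarith

theorem bddBelow_matMulExponentSet : BddBelow matMulExponentSet :=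
  ⟨2, fun _ => two_le_of_mem_matMulExponentSet⟩

theorem TensorRankLE.exists_matMulInOps {N r n : ℕ} (hN : 2 ≤ N)
    (hr : TensorRankLE (matMulTensor ℂ (Fin N) (Fin N) (Fin N)) r) (hn : 0 < n) :
    ∃ k L : ℕ, N ^ k ≤ N * n ∧ L ≤ (1 + 6 * N ^ 2 * k) * r ^ k ∧ MatMulInOps n L := by
  have : Nonempty (Fin N) := ⟨⟨0, by omega⟩⟩
  obtain ⟨L, hL, h⟩ := MatMulCostLE.pow_of_tensorRankLE hr (Nat.log N n + 1)
  rw [Fintype.card_fin] at hL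
  refine ⟨_, L, ?_, hL, (h.of_card_le ?_).matMulInOps⟩
  · rw [pow_succ']
    exact Nat.mul_le_mul_left N (Nat.pow_log_le_self N hn.ne')
  · simpa using (Nat.lt_pow_succ_log_self hN n).le

/-- The factor linear in the depth of the block recursion is absorbed by `n ^ ε`. -/
theorem TensorRankLE.logb_mem_matMulExponentSet {N r : ℕ} (hN : 2 ≤ N)
    (hr : TensorRankLE (matMulTensor ℂ (Fin N) (Fin N) (Fin N)) r) :
    Real.logb N r ∈ matMulExponentSet := by
  intro ε hε
  set τ := Real.logb N r
  have hN₁ : (1 : ℝ) < N := by exact_mod_cast hN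
  have hN₀ : (0 : ℝ) ≤ N := N.cast_nonneg
  have : Nonempty (Fin N) := ⟨⟨0, by omega⟩⟩
  have hr₁ : 1 ≤ r := (Nat.mul_pos Fintype.card_pos Fintype.card_pos).trans_le hr.card_mul_card_le
  have hNτ : (N : ℝ) ^ τ = r :=
    Real.rpow_logb (by positivity) hN₁.ne' (by exact_mod_cast hr₁)
  have hτ : 0 ≤ τ := Real.logb_nonneg hN₁ (by exact_mod_cast hr₁)
  have hNε : 1 < (N : ℝ) ^ ε := Real.one_lt_rpow hN₁ hε
  set D : ℝ := 1 + 6 * N ^ 2 / ((N : ℝ) ^ ε - 1)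
  have hD : 0 ≤ D := by have := sub_pos.2 hNε; positivity
  refine ⟨D * (N : ℝ) ^ (τ + ε), fun n hn => ?_⟩
  obtain ⟨k, L, hk, hL, h⟩ := hr.exists_matMulInOps hN hn
  refine ⟨L, ?_, h⟩
  calc (L : ℝ) ≤ (1 + 6 * N ^ 2 * k) * r ^ k := by exact_mod_cast hL
    _ ≤ D * ((N : ℝ) ^ ε) ^ k * r ^ k := by
      gcongr
      exact one_add_mul_le_mul_pow (by positivity) hNε k
    _ = D * ((N ^ k : ℕ) : ℝ) ^ (τ + ε) := by
      rw [← hNτ, mul_assoc, ← mul_pow, mul_comm (_ ^ ε), ← Real.rpow_add (by positivity),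
        Nat.cast_pow, Real.rpow_pow_comm hN₀]
    _ ≤ D * ((N * n : ℕ) : ℝ) ^ (τ + ε) :=
      mul_le_mul_of_nonneg_left (by gcongr) hD
    _ = D * (N : ℝ) ^ (τ + ε) * (n : ℝ) ^ (τ + ε) := by
      rw [Nat.cast_mul, Real.mul_rpow hN₀ n.cast_nonneg, mul_assoc]

theorem matMulExponentSet_nonempty : matMulExponentSet.Nonempty :=
  ⟨_, tensorRankLE_matMulTensor.logb_mem_matMulExponentSet le_rfl⟩

theorem two_le_matMulExponent : 2 ≤ matMulExponent :=
  le_csInf matMulExponentSet_nonempty fun _ => two_le_of_mem_matMulExponentSet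

theorem matMulExponent_mem : matMulExponent ∈ matMulExponentSet := by
  intro ε hε
  obtain ⟨w, hw, hlt⟩ := exists_lt_of_csInf_lt matMulExponentSet_nonempty
    (show sInf matMulExponentSet < matMulExponent + ε / 2 from
      lt_add_of_pos_right _ (by positivity))
  obtain ⟨C, hC⟩ := hw (ε / 2) (by positivity)
  have hC₀ : 0 ≤ C := by
    obtain ⟨L, hL, -⟩ := hC 1 one_pos
    simpa using (Nat.cast_nonneg L).trans hL
  refine ⟨C, fun n hn => ?_⟩
  obtain ⟨L, hL, h⟩ := hC n hn
  refine ⟨L, hL.trans ?_, h⟩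
  have hn₁ : (1 : ℝ) ≤ n := by exact_mod_cast hn
  exact mul_le_mul_of_nonneg_left (Real.rpow_le_rpow_of_exponent_le hn₁ (by linarith)) hC₀

theorem exists_tensorRankLE_le_rpow_matMulExponent_add {ε : ℝ} (hε : 0 < ε) :
    ∃ C : ℝ, ∀ n : ℕ, 0 < n → ∃ r : ℕ, (r : ℝ) ≤ C * (n : ℝ) ^ (matMulExponent + ε) ∧
      TensorRankLE (matMulTensor ℂ (Fin n) (Fin n) (Fin n)) r := by
  obtain ⟨C, hC⟩ := matMulExponent_mem ε hε
  refine ⟨2 * C, fun n hn => ?_⟩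
  obtain ⟨L, hL, h⟩ := hC n hn
  refine ⟨2 * L, ?_, h.tensorRankLE_matMulTensor⟩
  push_cast
  linarith

theorem TensorRankLE.rpow_matMulExponent_le_of_square {N r : ℕ}
    (h : TensorRankLE (matMulTensor ℂ (Fin N) (Fin N) (Fin N)) r) :
    (N : ℝ) ^ matMulExponent ≤ r := by
  have hω : matMulExponent ≠ 0 := (two_pos.trans_le two_le_matMulExponent).ne'
  obtain rfl | rfl | hN : N = 0 ∨ N = 1 ∨ 2 ≤ N := by omega
  · simp [Real.zero_rpow hω]
  · simpa using h.card_mul_card_le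
  · have : Nonempty (Fin N) := ⟨⟨0, by omega⟩⟩
    have hN₁ : (1 : ℝ) < N := by exact_mod_cast hN
    have hr : 0 < r := (Nat.mul_pos Fintype.card_pos Fintype.card_pos).trans_le h.card_mul_card_le
    rw [← Real.le_logb_iff_rpow_le hN₁ (by exact_mod_cast hr)]
    exact csInf_le bddBelow_matMulExponentSet (h.logb_mem_matMulExponentSet hN)

theorem TensorRankLE.rpow_matMulExponent_le {I J K : Type*} [DecidableEq I] [DecidableEq J]
    [DecidableEq K] [Fintype I] [Fintype J] [Fintype K] {r : ℕ}
    (h : TensorRankLE (matMulTensor ℂ I J K) r) :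
    ((Fintype.card I * Fintype.card J * Fintype.card K : ℕ) : ℝ) ^ matMulExponent ≤
      (r : ℝ) ^ 3 := by
  exact_mod_cast (h.matMulTensor_square (Fintype.card_fin _)).rpow_matMulExponent_le_of_square

/-! ### The group algebra tensor -/

/-- The structure tensor of the group algebra, in its cyclically symmetric form: the coefficients
of the trilinear form sending three elements of the algebra to the coefficient of `1` in their
product. -/
def groupTensor (R G : Type*) [CommSemiring R] [Monoid G] [DecidableEq G] : G → G → G → R :=
  fun a b c => if a * b * c = 1 then 1 else 0

theorem groupTensor_pi {R ι : Type*} [CommSemiring R] [Fintype ι] {G : ι → Type*}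
    [∀ t, Monoid (G t)] [∀ t, DecidableEq (G t)] (a b c : ∀ t, G t) :
    groupTensor R (∀ t, G t) a b c = ∏ t, groupTensor R (G t) (a t) (b t) (c t) := by
  simp only [groupTensor, funext_iff, Fintype.prod_ite_zero, Finset.prod_const_one, Pi.mul_apply,
    Pi.one_apply]

theorem TripleProductProperty.inv_mul_mul_inv_mul_mul_inv_mul_eq_one_iff {G : Type*} [Group G]
    {S₁ S₂ S₃ : Finset G} (h : TripleProductProperty S₁ S₂ S₃) (i i' : S₁) (j j' : S₂)
    (k k' : S₃) :
    ((i : G)⁻¹ * j) * ((j' : G)⁻¹ * k) * ((k' : G)⁻¹ * i') = 1 ↔ j = j' ∧ k = k' ∧ i' = i := by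
  constructor
  · intro heq
    have hconj : (i' * (i : G)⁻¹) * (j * (j' : G)⁻¹) * (k * (k' : G)⁻¹) = 1 :=
      calc (i' * (i : G)⁻¹) * (j * (j' : G)⁻¹) * (k * (k' : G)⁻¹)
          = i' * (((i : G)⁻¹ * j) * ((j' : G)⁻¹ * k) * ((k' : G)⁻¹ * i')) * (i' : G)⁻¹ := by group
        _ = 1 := by rw [heq]; group
    obtain ⟨h₁, h₂, h₃⟩ := h _ ⟨i', i'.2, i, i.2, rfl⟩ _ ⟨j, j.2, j', j'.2, rfl⟩ _
      ⟨k, k.2, k', k'.2, rfl⟩ hconj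
    exact ⟨Subtype.ext (mul_inv_eq_one.1 h₂), Subtype.ext (mul_inv_eq_one.1 h₃),
      Subtype.ext (mul_inv_eq_one.1 h₁)⟩
  · rintro ⟨rfl, rfl, rfl⟩
    group

theorem TripleProductProperty.tensorRankLE_matMulTensor {R G : Type*} [CommSemiring R] [Group G]
    [DecidableEq G] {S₁ S₂ S₃ : Finset G} (h : TripleProductProperty S₁ S₂ S₃) {r : ℕ}
    (hr : TensorRankLE (groupTensor R G) r) : TensorRankLE (matMulTensor R S₁ S₂ S₃) r :=
  (hr.comap (fun x : S₁ × S₂ => (x.1 : G)⁻¹ * x.2) (fun y : S₂ × S₃ => (y.1 : G)⁻¹ * y.2)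
    (fun z : S₃ × S₁ => (z.1 : G)⁻¹ * z.2)).congr fun x y z => by
      simp only [groupTensor, matMulTensor, h.inv_mul_mul_inv_mul_mul_inv_mul_eq_one_iff]

theorem TripleProductProperty.pi {ι : Type*} [Fintype ι] [DecidableEq ι] {G : ι → Type*}
    [∀ t, Group (G t)] {S₁ S₂ S₃ : ∀ t, Finset (G t)}
    (h : ∀ t, TripleProductProperty (S₁ t) (S₂ t) (S₃ t)) :
    TripleProductProperty (Fintype.piFinset S₁) (Fintype.piFinset S₂) (Fintype.piFinset S₃) := by
  rintro _ ⟨a, ha, a', ha', rfl⟩ _ ⟨b, hb, b', hb', rfl⟩ _ ⟨c, hc, c', hc', rfl⟩ habc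
  simp only [Fintype.mem_piFinset] at ha ha' hb hb' hc hc'
  have hcoord t := h t _ ⟨a t, ha t, a' t, ha' t, rfl⟩ _ ⟨b t, hb t, b' t, hb' t, rfl⟩ _
    ⟨c t, hc t, c' t, hc' t, rfl⟩ (congrFun habc t)
  exact ⟨funext fun t => (hcoord t).1, funext fun t => (hcoord t).2.1,
    funext fun t => (hcoord t).2.2⟩

namespace Realizes

theorem pi {ι : Type*} [Fintype ι] {G : ι → Type*} [∀ t, Group (G t)] {n m p : ι → ℕ}
    (h : ∀ t, Realizes (G t) (n t) (m t) (p t)) :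
    Realizes (∀ t, G t) (∏ t, n t) (∏ t, m t) (∏ t, p t) := by
  classical
  choose S₁ S₂ S₃ h₁ h₂ h₃ hS using h
  refine ⟨_, _, _, ?_, ?_, ?_, TripleProductProperty.pi hS⟩ <;>
    simp only [Fintype.card_piFinset, h₁, h₂, h₃]

variable {G : Type*} [Group G] {n m p : ℕ}

theorem pow (h : Realizes G n m p) (l : ℕ) : Realizes (Fin l → G) (n ^ l) (m ^ l) (p ^ l) := by
  simpa using Realizes.pi fun _ : Fin l => h

theorem rpow_matMulExponent_le_of_tensorRankLE [DecidableEq G] (h : Realizes G n m p) {r : ℕ}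
    (hr : TensorRankLE (groupTensor ℂ G) r) :
    ((n * m * p : ℕ) : ℝ) ^ matMulExponent ≤ (r : ℝ) ^ 3 := by
  obtain ⟨S₁, S₂, S₃, rfl, rfl, rfl, hS⟩ := h
  simpa only [Fintype.card_coe] using (hS.tensorRankLE_matMulTensor hr).rpow_matMulExponent_le

end Realizes

/-! ### Decomposing the group algebra tensor -/

theorem exists_eq_trace_mul {R m n : Type*} [CommSemiring R] [Fintype m] [Fintype n]
    (φ : Matrix m n R →ₗ[R] R) : ∃ P : Matrix n m R, ∀ Y, φ Y = (Y * P).trace := by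
  classical
  refine ⟨.of fun q p => φ (Matrix.single p q 1), fun Y => ?_⟩
  have hentry (p : m) (q : n) :
      φ (Matrix.single p q (Y p q)) = Y p q * φ (Matrix.single p q 1) := by
    rw [← smul_eq_mul, ← map_smul, Matrix.smul_single, smul_eq_mul, mul_one]
  conv_lhs => rw [Matrix.matrix_eq_sum_single Y]
  simp only [map_sum, hentry, Matrix.trace, Matrix.diag, Matrix.mul_apply, Matrix.of_apply]

section Wedderburn

variable {R κ : Type*} [CommSemiring R] [Fintype κ] {n : κ → Type*} [∀ i, Fintype (n i)]

theorem exists_eq_sum_trace_mul (φ : (∀ i, Matrix (n i) (n i) R) →ₗ[R] R) :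
    ∃ P : ∀ i, Matrix (n i) (n i) R, ∀ Y, φ Y = ∑ i, (Y i * P i).trace := by
  classical
  choose P hP using fun i => exists_eq_trace_mul
    (φ ∘ₗ LinearMap.single R (fun i => Matrix (n i) (n i) R) i)
  refine ⟨P, fun Y => ?_⟩
  calc φ Y = ∑ i, φ (Pi.single i (Y i)) := by rw [← map_sum, Finset.univ_sum_single]
    _ = ∑ i, (Y i * P i).trace := Finset.sum_congr rfl fun i _ => hP i (Y i)

theorem exists_groupTensor_eq_sum_trace [∀ i, DecidableEq (n i)] {G : Type*} [Monoid G]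
    [DecidableEq G] (e : MonoidAlgebra R G ≃ₐ[R] (∀ i, Matrix (n i) (n i) R)) :
    ∃ A B C : ∀ i, G → Matrix (n i) (n i) R,
      ∀ a b c, groupTensor R G a b c = ∑ i, (A i a * B i b * C i c).trace := by
  let φ : (∀ i, Matrix (n i) (n i) R) →ₗ[R] R :=
    { toFun := fun Y => (e.symm Y).coeff 1
      map_add' := fun Y Z => by simp
      map_smul' := fun c Y => by simp }
  obtain ⟨P, hP⟩ := exists_eq_sum_trace_mul φ
  let X (a : G) : ∀ i, Matrix (n i) (n i) R := e (MonoidAlgebra.single a 1)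
  have hX (a b c : G) : X a * X b * X c = e (MonoidAlgebra.single (a * b * c) 1) := by
    simp only [X, ← map_mul, MonoidAlgebra.single_mul_single, mul_one]
  refine ⟨fun i a => X a i, fun i b => X b i, fun i c => X c i * P i, fun a b c => ?_⟩
  calc groupTensor R G a b c = φ (X a * X b * X c) := by
        rw [hX]
        simp [φ, groupTensor, Finsupp.single_apply]
    _ = ∑ i, (X a i * X b i * (X c i * P i)).trace := by
        simp only [hP, Pi.mul_apply, mul_assoc]

end Wedderburn

/-- The Kronecker product of a finite family of matrices. -/
def piKronecker {R ι : Type*} [CommSemiring R] [Fintype ι] {m n : ι → Type*}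
    (M : ∀ t, Matrix (m t) (n t) R) : Matrix (∀ t, m t) (∀ t, n t) R :=
  .of fun p q => ∏ t, M t (p t) (q t)

section PiKronecker

variable {R ι : Type*} [CommSemiring R] [Fintype ι] [DecidableEq ι] {l m n : ι → Type*}
  [∀ t, Fintype (m t)]

theorem piKronecker_mul (M : ∀ t, Matrix (l t) (m t) R) (N : ∀ t, Matrix (m t) (n t) R) :
    piKronecker M * piKronecker N = piKronecker fun t => M t * N t := by
  ext p q
  simp only [piKronecker, Matrix.mul_apply, Matrix.of_apply, ← Finset.prod_mul_distrib,
    Finset.prod_univ_sum, Fintype.piFinset_univ]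

theorem trace_piKronecker (M : ∀ t, Matrix (m t) (m t) R) :
    (piKronecker M).trace = ∏ t, (M t).trace := by
  simp only [piKronecker, Matrix.trace, Matrix.diag, Matrix.of_apply, Finset.prod_univ_sum,
    Fintype.piFinset_univ]

end PiKronecker

theorem TensorRankLE.prod_trace_mul_mul {R ι : Type*} [CommSemiring R] [Fintype ι]
    {I J K X Y Z : ι → Type*} [∀ t, Fintype (I t)] [∀ t, Fintype (J t)]
    [∀ t, Fintype (K t)] [∀ t, DecidableEq (I t)] [∀ t, DecidableEq (J t)]
    [∀ t, DecidableEq (K t)] {r : ℕ}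
    (h : TensorRankLE (matMulTensor R (∀ t, I t) (∀ t, J t) (∀ t, K t)) r)
    (A : ∀ t, X t → Matrix (I t) (J t) R) (B : ∀ t, Y t → Matrix (J t) (K t) R)
    (C : ∀ t, Z t → Matrix (K t) (I t) R) :
    TensorRankLE (fun (x : ∀ t, X t) (y : ∀ t, Y t) (z : ∀ t, Z t) =>
      ∏ t, (A t (x t) * B t (y t) * C t (z t)).trace) r := by
  classical
  refine (h.trace_mul_mul (fun x : ∀ t, X t => piKronecker fun t => A t (x t))
    (fun y : ∀ t, Y t => piKronecker fun t => B t (y t))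
    (fun z : ∀ t, Z t => piKronecker fun t => C t (z t))).congr fun x y z => ?_
  rw [piKronecker_mul, piKronecker_mul, trace_piKronecker]

section CharacterDegrees

variable {G : Type*} [Group G] {k : ℕ} {d : Fin k → ℕ}

theorem IsCharacterDegrees.exists_tensorRankLE_groupTensor_pow [DecidableEq G]
    (hd : IsCharacterDegrees G d) {w C : ℝ}
    (hC : ∀ n : ℕ, 0 < n → ∃ r : ℕ, (r : ℝ) ≤ C * (n : ℝ) ^ w ∧
      TensorRankLE (matMulTensor ℂ (Fin n) (Fin n) (Fin n)) r) (l : ℕ) :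
    ∃ r : ℕ, (r : ℝ) ≤ C * (∑ i, (d i : ℝ) ^ w) ^ l ∧
      TensorRankLE (groupTensor ℂ (Fin l → G)) r := by
  obtain ⟨hpos, ⟨e⟩⟩ := hd
  obtain ⟨A, B, D, hABD⟩ := exists_groupTensor_eq_sum_trace e
  choose r hr hrank using fun f : Fin l → Fin k => hC (∏ t, d (f t))
    (Finset.prod_pos fun t _ => hpos _)
  refine ⟨∑ f, r f, ?_, ?_⟩
  · calc ((∑ f, r f : ℕ) : ℝ) = ∑ f, (r f : ℝ) := Nat.cast_sum _ _
      _ ≤ ∑ f : Fin l → Fin k, C * ((∏ t, d (f t) : ℕ) : ℝ) ^ w := Finset.sum_le_sum fun f _ => hr f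
      _ = C * (∑ i, (d i : ℝ) ^ w) ^ l := by
        rw [← Finset.mul_sum, Fintype.sum_pow]
        congr! with f
        rw [Nat.cast_prod, Real.finsetProd_rpow _ _ fun t _ => (d (f t)).cast_nonneg]
  · have hterm (f : Fin l → Fin k) : TensorRankLE (fun a b c : Fin l → G =>
        ∏ t, (A (f t) (a t) * B (f t) (b t) * D (f t) (c t)).trace) (r f) :=
      ((hrank f).matMulTensor_congr finPiFinEquiv finPiFinEquiv finPiFinEquiv).prod_trace_mul_mul
        (fun t => A (f t)) (fun t => B (f t)) (fun t => D (f t))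
    refine (TensorRankLE.sum hterm).congr fun a b c => ?_
    rw [groupTensor_pi]
    simp only [hABD, Finset.prod_univ_sum, Fintype.piFinset_univ]

/-- Passing to the powers of `G` removes the constant `C`, and letting the exponent tend to `ω`
removes the `ε` of the rank bound. -/
theorem Realizes.rpow_matMulExponent_le {n m p : ℕ} (h : Realizes G n m p)
    (hd : IsCharacterDegrees G d) :
    ((n * m * p : ℕ) : ℝ) ^ matMulExponent ≤ (∑ i, (d i : ℝ) ^ matMulExponent) ^ 3 := by
  classical
  have hstep (ε : ℝ) (hε : 0 < ε) : ((n * m * p : ℕ) : ℝ) ^ matMulExponent ≤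
      (∑ i, (d i : ℝ) ^ (matMulExponent + ε)) ^ 3 := by
    obtain ⟨C, hC⟩ := exists_tensorRankLE_le_rpow_matMulExponent_add hε
    refine le_of_forall_pow_le_mul_pow (C := C ^ 3) (by positivity) fun l => ?_
    obtain ⟨r, hr, hrank⟩ := hd.exists_tensorRankLE_groupTensor_pow hC l
    calc (((n * m * p : ℕ) : ℝ) ^ matMulExponent) ^ l
        = ((n ^ l * m ^ l * p ^ l : ℕ) : ℝ) ^ matMulExponent := by
          rw [← mul_pow, ← mul_pow, Nat.cast_pow, Real.rpow_pow_comm (Nat.cast_nonneg _)]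
      _ ≤ (r : ℝ) ^ 3 := (h.pow l).rpow_matMulExponent_le_of_tensorRankLE hrank
      _ ≤ (C * (∑ i, (d i : ℝ) ^ (matMulExponent + ε)) ^ l) ^ 3 := by gcongr
      _ = C ^ 3 * ((∑ i, (d i : ℝ) ^ (matMulExponent + ε)) ^ 3) ^ l := by ring
  have hcont : Continuous fun ε : ℝ => (∑ i, (d i : ℝ) ^ (matMulExponent + ε)) ^ 3 := by
    refine (continuous_finsetSum _ fun i _ => ?_).pow 3
    have hi : (d i : ℝ) ≠ 0 := by exact_mod_cast (hd.1 i).ne'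
    exact Continuous.rpow continuous_const (by fun_prop) fun _ => Or.inl hi
  have htend := (hcont.tendsto 0).mono_left (nhdsWithin_le_nhds (s := Set.Ioi 0))
  simp only [add_zero] at htend
  exact ge_of_tendsto htend (Filter.eventually_of_mem self_mem_nhdsWithin hstep)

end CharacterDegrees

theorem exists_realizes_natCard_rpow_eq (G : Type*) [Group G] [Finite G] :
    ∃ n m p : ℕ, Realizes G n m p ∧
      (Nat.card G : ℝ) ^ (3 / pseudoExponent G) = (n * m * p : ℕ) := by
  rcases subsingleton_or_nontrivial G with hG | hG
  · refine ⟨1, 1, 1, ⟨{1}, {1}, {1}, rfl, rfl, rfl, fun _ _ _ _ _ _ _ => ?_⟩, by simp⟩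
    exact ⟨Subsingleton.elim _ _, Subsingleton.elim _ _, Subsingleton.elim _ _⟩
  · obtain ⟨n, m, p, hn, hm, hp, -, hreal, hα⟩ := (isLeast_pseudoExponent G).1
    refine ⟨n, m, p, hreal, ?_⟩
    have hcard : (1 : ℝ) < Nat.card G := by exact_mod_cast Finite.one_lt_card
    have hexp : 3 / pseudoExponent G = Real.logb (Nat.card G) (n * m * p : ℕ) := by
      rw [hα, Real.logb, div_div_eq_mul_div, mul_div_mul_left _ _ three_ne_zero]
    rw [hexp, Real.rpow_logb (by positivity) hcard.ne' (by positivity)]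

theorem mainTheorem2 (G : Type*) [Group G] [Finite G] (α : ℝ) (hα : pseudoExponent G = α)
    {k : ℕ} (d : Fin k → ℕ) (hd : IsCharacterDegrees G d) :
    (Nat.card G : ℝ) ^ (matMulExponent / α) ≤ ∑ i, (d i : ℝ) ^ matMulExponent := by
  obtain ⟨n, m, p, hreal, hnmp⟩ := exists_realizes_natCard_rpow_eq G
  refine le_of_pow_le_pow_left₀ three_ne_zero (by positivity) ?_
  calc ((Nat.card G : ℝ) ^ (matMulExponent / α)) ^ 3
      = ((Nat.card G : ℝ) ^ (3 / pseudoExponent G)) ^ matMulExponent := by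
        rw [← Real.rpow_natCast, ← Real.rpow_mul (Nat.cast_nonneg _),
          ← Real.rpow_mul (Nat.cast_nonneg _), hα]
        congr 1
        push_cast
        ring
    _ = ((n * m * p : ℕ) : ℝ) ^ matMulExponent := by rw [hnmp]
    _ ≤ (∑ i, (d i : ℝ) ^ matMulExponent) ^ 3 := hreal.rpow_matMulExponent_le hd
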